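/- \textbf{Theorem (Congruence).} \emph{Setting.} Let $\mathfrak D$ be a minimal algebra of a (many-sorted) signature $\Sigma$ that has a sort $\mathbf D$ of data and at least one constant or operator with result sort $\mathbf D$. Let $\mathcal V$ be a countably infinite set of flexible variables, $\mathsf A$ a finite set of basic actions, and $\gamma$ a commutative and associative function on $(\mathsf A\cup\{\delta\})^2$ with values in $\mathsf A\cup\{\delta\}$ and $\gamma(\delta,a)=\delta$. \emph{Data terms} $e$ are closed terms of sort $\mathbf D$ over $\Sigma$ with the flexible variables as additional constants; those without flexible variables are called \emph{values}. \emph{Conditions} $\phi$ are closed first-order formulas built from equations between data terms, truth and falsity by $\neg,\wedge,\vee,\to$ and quantification over logical variables of sort $\mathbf D$. $\mathfrak D\models\phi$ means that $\phi$ holds under all valuations of the flexible variables; $\phi$ is \emph{satisfiable} if $\mathfrak D\not\models\phi\leftrightarrow\mathrm{false}$. An \emph{evaluation map} is a function $\sigma$ that sends each $v\in\mathcal V$ to a value or to $v$ itself; it is extended homomorphically to data terms and conditions; for a value $d$, $\sigma[d/v]$ is the evaluation map that sends $v$ to $d$ and agrees with $\sigma$ elsewhere. \emph{Actions} are $a$,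 $a(e_1,\dots,e_n)$ and $[v:=e]$ with $a\in\mathsf A$, $n\ge 0$, $v\in\mathcal V$. \emph{Process terms} are $$p ::= \delta \mid \epsilon \mid \alpha \mid p+p \mid p\cdot p \mid p^{*}p \mid \phi:\to p \mid p\parallel p \mid p\,\lfloor\!\lfloor\, p \mid p\mid p \mid \partial_H(p) \mid \mathsf V_\sigma(p)$$ with $\alpha$ an action, $H\subseteq\mathsf A$, and $\sigma$ an evaluation map. \emph{Transitions.} The relations $p\downarrow^{\phi}$ (termination under $\phi$) and $p\xrightarrow{\phi,\alpha}p'$ are the least ones closed under the following rules, each of which applies only if the condition in its conclusion is satisfiable when that condition is formed by conjunction or by $\sigma$. Here $a,b,c\in\mathsf A$. \begin{itemize} \item $\epsilon\downarrow^{\mathrm{true}}$ and $\alpha\xrightarrow{\mathrm{true},\alpha}\epsilon$. \item $x+y$ terminates and moves as $x$ does and as $y$ does. \item If $x\downarrow^\phi$ and $y\downarrow^\psi$, then $x\cdot y\downarrow^{\phi\wedge\psi}$; if $x\downarrow^\phi$ and $y\xrightarrow{\psi,\alpha}y'$, then $x\cdot y\xrightarrow{\phi\wedge\psi,\alpha}y'$;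 if $x\xrightarrow{\phi,\alpha}x'$, then $x\cdot y\xrightarrow{\phi,\alpha}x'\cdot y$. \item $x^{*}y$ terminates and moves as $y$ does; if $x\xrightarrow{\phi,\alpha}x'$, then $x^{*}y\xrightarrow{\phi,\alpha}x'\cdot(x^{*}y)$. \item If $x\downarrow^\phi$, then $\psi:\to x\downarrow^{\phi\wedge\psi}$; if $x\xrightarrow{\phi,\alpha}x'$, then $\psi:\to x\xrightarrow{\phi\wedge\psi,\alpha}x'$. \item If $x\downarrow^\phi$ and $y\downarrow^\psi$, then $x\parallel y\downarrow^{\phi\wedge\psi}$. If $x\xrightarrow{\phi,\alpha}x'$, then $x\parallel y\xrightarrow{\phi,\alpha}x'\parallel y$, $\;y\parallel x\xrightarrow{\phi,\alpha}y\parallel x'$ and $x\,\lfloor\!\lfloor\,y\xrightarrow{\phi,\alpha}x'\parallel y$. \item If $\gamma(a,b)=c$, $x\xrightarrow{\phi,a}x'$ and $y\xrightarrow{\psi,b}y'$, then both $x\parallel y$ and $x\mid y$ have a $(\phi\wedge\psi,\,c)$-transition to $x'\parallel y'$. If $\gamma(a,b)=c$, $x\xrightarrow{\phi,a(e_1,\dots,e_n)}x'$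 and $y\xrightarrow{\psi,b(e_1',\dots,e_n')}y'$, then both have a $(\phi\wedge\psi\wedge e_1=e_1'\wedge\dots\wedge e_n=e_n',\;c(e_1,\dots,e_n))$-transition to $x'\parallel y'$. \item If $x\downarrow^\phi$, then $\partial_H(x)\downarrow^\phi$; if $x\xrightarrow{\phi,\alpha}x'$ and $\alpha$ is not of the form $a$ or $a(e_1,\dots,e_n)$ with $a\in H$, then $\partial_H(x)\xrightarrow{\phi,\alpha}\partial_H(x')$. \item If $x\downarrow^\phi$, then $\mathsf V_\sigma(x)\downarrow^{\sigma(\phi)}$. If $x\xrightarrow{\phi,a}x'$, then $\mathsf V_\sigma(x)\xrightarrow{\sigma(\phi),a}\mathsf V_\sigma(x')$; if $x\xrightarrow{\phi,a(e_1,\dots,e_n)}x'$, then $\mathsf V_\sigma(x)\xrightarrow{\sigma(\phi),a(\sigma(e_1),\dots,\sigma(e_n))}\mathsf V_\sigma(x')$. If $x\xrightarrow{\phi,[v:=e]}x'$, then $\mathsf V_\sigma(x)\xrightarrow{\sigma(\phi),[v:=\sigma(e)]}\mathsf V_{\sigma'}(x')$, where $\sigma'=\sigma[\sigma(e)/v]$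 if $\sigma(v)$ is a value (the rule applies in this case only if $\sigma(e)$ is a value, so that $\sigma'$ is an evaluation map), and $\sigma'=\sigma$ if $\sigma(v)=v$. \end{itemize} \emph{Bisimulation.} Actions are \emph{data equivalent}, $\alpha\simeq\alpha'$, if both are the same $a$; or they are $a(e_1,\dots,e_n)$ and $a(e_1',\dots,e_n')$ with $\mathfrak D\models e_i=e_i'$ for all $i$; or they are $[v:=e]$ and $[v:=e']$ with $\mathfrak D\models e=e'$. A \emph{(splitting) bisimulation} is a relation $R$ on process terms such that $(p,q)\in R$ implies: whenever $p\xrightarrow{\phi,\alpha}p'$, there is a finite set $\Psi$ of satisfiable conditions with $\mathfrak D\models\phi\to\bigvee\Psi$ such that for every $\psi\in\Psi$ there are $\alpha'\simeq\alpha$ and $q'$ with $q\xrightarrow{\psi,\alpha'}q'$ and $(p',q')\in R$; whenever $p\downarrow^\phi$, there is a finite set $\Psi$ of satisfiable conditions with $\mathfrak D\models\phi\to\bigvee\Psi$ and $q\downarrow^\psi$ for every $\psi\in\Psi$; and the same two conditions with the roles of $p$ and $q$ exchanged. Write $p\leftrightarrows q$ if some bisimulation contains $(p,q)$. Say that $\sigma$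 \emph{has defined updates on} $p$ if, whenever a process term reachable from $p$ by finitely many transitions can perform an assignment action $[v:=e]$ (under some condition) and $\sigma(v)$ is a value, $\sigma(e)$ is a value as well. (This holds, for instance, if $\sigma$ maps all flexible variables that occur in $p$ to values.) \emph{Claim.} $\leftrightarrows$ is an equivalence relation, and for all process terms $p,q,p',q'$ and all conditions $\phi$, if $p\leftrightarrows p'$ and $q\leftrightarrows q'$, then $p+q\leftrightarrows p'+q'$, $\;p\cdot q\leftrightarrows p'\cdot q'$, $\;p^{*}q\leftrightarrows p'^{*}q'$, $\;\phi:\to p\leftrightarrows\phi:\to p'$, $\;p\parallel q\leftrightarrows p'\parallel q'$, $\;p\,\lfloor\!\lfloor\,q\leftrightarrows p'\,\lfloor\!\lfloor\,q'$, $\;p\mid q\leftrightarrows p'\mid q'$, $\;\partial_H(p)\leftrightarrows\partial_H(p')$ for all $H\subseteq\mathsf A$, and $\mathsf V_\sigma(p)\leftrightarrows\mathsf V_\sigma(p')$ for all evaluation maps $\sigma$ that have defined updates on $p$ and on $p'$. -/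

import Mathlib

namespace ACP

/-- A (single- or many-sorted) signature with a distinguished sort `data` and at least one
constant or operator whose result sort is `data`. A constant is an operator with `dom o = []`. -/
structure Signature where
  Srt : Type*
  data : Srt
  Op : Type*
  dom : Op → List Srt
  cod : Op → Srt
  exists_data : ∃ o, cod o = data

/-- Terms over `S` whose leaves may also be elements of `X`, used as symbols of sort `data`. -/
inductive DTerm (S : Signature) (X : Type*) : S.Srt → Type _
  | var (x : X) : DTerm S X S.data
  | op (o : S.Op) (args : (i : Fin (S.dom o).length) → DTerm S X ((S.dom o).get i)) :
      DTerm S X (S.cod o)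

/-- Simultaneous substitution of terms for the symbols from `X`. -/
def DTerm.bind {S : Signature} {X Y : Type*} (f : X → DTerm S Y S.data) :
    {s : S.Srt} → DTerm S X s → DTerm S Y s
  | _, .var x => f x
  | _, .op o args => .op o (fun i => (args i).bind f)

/-- Closed terms over the signature, of sort `data`. -/
abbrev DataVal (S : Signature) := DTerm S Empty S.data

/-- Closed terms of sort `data`, in which flexible variables (elements of `V`) are constants. -/
abbrev DataTerm (S : Signature) (V : Type*) := DTerm S V S.data

/-- A closed term over the signature, regarded as a term with symbols from `X`. -/
def DTerm.embed {S : Signature} {X : Type*} (d : DataVal S) : DTerm S X S.data :=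
  d.bind (fun x => x.elim)

/-- Algebras of a signature. -/
structure Algebra (S : Signature) where
  Carrier : S.Srt → Type*
  interp : (o : S.Op) → ((i : Fin (S.dom o).length) → Carrier ((S.dom o).get i)) →
    Carrier (S.cod o)

/-- The value of a term in an algebra. -/
def DTerm.value {S : Signature} (D : Algebra S) {X : Type*} (ν : X → D.Carrier S.data) :
    {s : S.Srt} → DTerm S X s → D.Carrier s
  | _, .var x => ν x
  | _, .op o args => D.interp o (fun i => (args i).value D ν)

/-- A minimal algebra: each element of each carrier is the value of a closed term. -/
def Algebra.IsMinimal {S : Signature} (D : Algebra S) : Prop :=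
  ∀ (s : S.Srt) (x : D.Carrier s), ∃ t : DTerm S Empty s, t.value D (fun y => y.elim) = x

/-- Terms of sort condition with at most `n` free logical variables of sort `data`, written with
de Bruijn indices: `Sum.inl v` is the flexible variable `v`, and `Sum.inr i` is the logical
variable bound by the `i`-th enclosing quantifier, counted from the inside. -/
inductive Cond (S : Signature) (V : Type*) : ℕ → Type _
  | eq {n : ℕ} (e e' : DTerm S (V ⊕ Fin n) S.data) : Cond S V n
  | tru {n : ℕ} : Cond S V n
  | fls {n : ℕ} : Cond S V n
  | not {n : ℕ} (φ : Cond S V n) : Cond S V n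
  | and {n : ℕ} (φ ψ : Cond S V n) : Cond S V n
  | or {n : ℕ} (φ ψ : Cond S V n) : Cond S V n
  | imp {n : ℕ} (φ ψ : Cond S V n) : Cond S V n
  | all {n : ℕ} (φ : Cond S V (n + 1)) : Cond S V n
  | ex {n : ℕ} (φ : Cond S V (n + 1)) : Cond S V n

/-- Closed terms of sort condition. -/
abbrev CondTerm (S : Signature) (V : Type*) := Cond S V 0

/-- The condition `e = e'` for terms without logical variables. -/
def CondTerm.eqData {S : Signature} {V : Type*} (e e' : DataTerm S V) : CondTerm S V :=
  .eq (e.bind (fun v => .var (.inl v))) (e'.bind (fun v => .var (.inl v)))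

/-- The condition `φ ↔ ψ`. -/
def CondTerm.iff {S : Signature} {V : Type*} (φ ψ : CondTerm S V) : CondTerm S V :=
  .and (.imp φ ψ) (.imp ψ φ)

/-- The disjunction of the conditions in a list; it is falsity for the empty list. -/
def CondTerm.bigOr {S : Signature} {V : Type*} (Ψ : List (CondTerm S V)) : CondTerm S V :=
  Ψ.foldr .or .fls

/-- The condition `χ ∧ e₁ = e₁' ∧ … ∧ eₙ = eₙ'`. -/
def CondTerm.andEqs {S : Signature} {V : Type*} (χ : CondTerm S V) (es es' : List (DataTerm S V)) :
    CondTerm S V :=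
  (List.zipWith CondTerm.eqData es es').foldl .and χ

/-- Satisfaction in `D`, where flexible variables are valued by `ν` and logical variables
by `ρ`. -/
def Cond.Holds {S : Signature} (D : Algebra S) {V : Type*} (ν : V → D.Carrier S.data) :
    {n : ℕ} → Cond S V n → (Fin n → D.Carrier S.data) → Prop
  | _, .eq e e', ρ => e.value D (Sum.elim ν ρ) = e'.value D (Sum.elim ν ρ)
  | _, .tru, _ => True
  | _, .fls, _ => False
  | _, .not φ, ρ => ¬ φ.Holds D ν ρ
  | _, .and φ ψ, ρ => φ.Holds D ν ρ ∧ ψ.Holds D ν ρ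
  | _, .or φ ψ, ρ => φ.Holds D ν ρ ∨ ψ.Holds D ν ρ
  | _, .imp φ ψ, ρ => φ.Holds D ν ρ → ψ.Holds D ν ρ
  | _, .all φ, ρ => ∀ d, φ.Holds D ν (Fin.cons d ρ)
  | _, .ex φ, ρ => ∃ d, φ.Holds D ν (Fin.cons d ρ)

/-- `D ⊨ φ`: the formula `φ` holds in `D` under all valuations of the flexible variables. -/
def Algebra.Valid {S : Signature} (D : Algebra S) {V : Type*} (φ : CondTerm S V) : Prop :=
  ∀ ν : V → D.Carrier S.data, φ.Holds D ν Fin.elim0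

/-- `D ⊭ φ ↔ falsity`, i.e. `φ` is satisfiable in `D`. -/
def Algebra.Satisfiable {S : Signature} (D : Algebra S) {V : Type*} (φ : CondTerm S V) : Prop :=
  ¬ D.Valid (φ.iff .fls)

/-- Evaluation maps: functions `σ` from flexible variables to closed terms over the signature or
flexible variables, with `σ v = v` whenever `σ v` is a flexible variable. -/
structure EvalMap (S : Signature) (V : Type*) where
  toFun : V → DataVal S ⊕ V
  eq_self : ∀ v w, toFun v = .inr w → w = v

/-- `σ v` as a term with symbols from `X`, where `X` includes the flexible variables by `ι`. -/
def EvalMap.term {S : Signature} {V X : Type*} (σ : EvalMap S V) (ι : V → X) (v : V) :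
    DTerm S X S.data :=
  match σ.toFun v with
  | .inl d => d.embed
  | .inr w => .var (ι w)

/-- The homomorphic extension of `σ` to terms of sort `data`. -/
def EvalMap.onData {S : Signature} {V : Type*} (σ : EvalMap S V) (e : DataTerm S V) :
    DataTerm S V :=
  e.bind (σ.term id)

/-- The homomorphic extension of `σ` to terms of sort condition; it leaves logical variables
unchanged. -/
def EvalMap.onCond {S : Signature} {V : Type*} (σ : EvalMap S V) :
    {n : ℕ} → Cond S V n → Cond S V n
  | _, .eq e e' => .eq (e.bind (Sum.elim (σ.term .inl) (fun i => .var (.inr i))))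
      (e'.bind (Sum.elim (σ.term .inl) (fun i => .var (.inr i))))
  | _, .tru => .tru
  | _, .fls => .fls
  | _, .not φ => .not (σ.onCond φ)
  | _, .and φ ψ => .and (σ.onCond φ) (σ.onCond ψ)
  | _, .or φ ψ => .or (σ.onCond φ) (σ.onCond ψ)
  | _, .imp φ ψ => .imp (σ.onCond φ) (σ.onCond ψ)
  | _, .all φ => .all (σ.onCond φ)
  | _, .ex φ => .ex (σ.onCond φ)

/-- `σ v` is a closed term over the signature. -/
def EvalMap.Assigned {S : Signature} {V : Type*} (σ : EvalMap S V) (v : V) : Prop :=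
  ∃ d, σ.toFun v = .inl d

open Classical in
/-- The evaluation map that maps `v` to the closed term `d` and agrees with `σ` elsewhere. -/
noncomputable def EvalMap.update {S : Signature} {V : Type*} (σ : EvalMap S V) (v : V)
    (d : DataVal S) : EvalMap S V where
  toFun := Function.update σ.toFun v (.inl d)
  eq_self := by
    intro u w h
    by_cases huv : u = v
    · subst huv
      simp at h
    · rw [Function.update_of_ne huv] at h
      exact σ.eq_self u w h

/-- Actions: basic actions `a`, data parameterized actions `a(e₁,…,eₙ)` with `n ≥ 0`, and
assignment actions `[v := e]`. -/
inductive Action (S : Signature) (V A : Type*)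
  | basic (a : A)
  | param (a : A) (es : List (DataTerm S V))
  | assign (v : V) (e : DataTerm S V)

/-- Closed terms of sort process. -/
inductive Proc (S : Signature) (V A : Type*)
  | inaction
  | empty
  | act (α : Action S V A)
  | alt (p q : Proc S V A)
  | seq (p q : Proc S V A)
  | iter (p q : Proc S V A)
  | guard (φ : CondTerm S V) (p : Proc S V A)
  | par (p q : Proc S V A)
  | leftMerge (p q : Proc S V A)
  | commMerge (p q : Proc S V A)
  | encap (H : Set A) (p : Proc S V A)
  | eval (σ : EvalMap S V) (p : Proc S V A)

/-- Communication functions on `A ∪ {δ}`, where `none` stands for `δ`. -/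
structure CommFun (A : Type*) where
  toFun : Option A → Option A → Option A
  comm : ∀ a b, toFun a b = toFun b a
  assoc : ∀ a b c, toFun (toFun a b) c = toFun a (toFun b c)
  delta : ∀ a, toFun none a = none

/-- `Terminates D p φ`: `p` can terminate successfully under condition `φ`. -/
inductive Terminates {S : Signature} (D : Algebra S) {V A : Type*} :
    Proc S V A → CondTerm S V → Prop
  | empty : Terminates D .empty .tru
  | altL {x y φ} : Terminates D x φ → Terminates D (.alt x y) φ
  | altR {x y φ} : Terminates D y φ → Terminates D (.alt x y) φ
  | seq {x y φ ψ} : Terminates D x φ → Terminates D y ψ → D.Satisfiable (.and φ ψ) →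
      Terminates D (.seq x y) (.and φ ψ)
  | iter {x y φ} : Terminates D y φ → Terminates D (.iter x y) φ
  | guard {x φ ψ} : Terminates D x φ → D.Satisfiable (.and φ ψ) →
      Terminates D (.guard ψ x) (.and φ ψ)
  | par {x y φ ψ} : Terminates D x φ → Terminates D y ψ → D.Satisfiable (.and φ ψ) →
      Terminates D (.par x y) (.and φ ψ)
  | encap {H x φ} : Terminates D x φ → Terminates D (.encap H x) φ
  | eval {σ x φ} : Terminates D x φ → D.Satisfiable (σ.onCond φ) →
      Terminates D (.eval σ x) (σ.onCond φ)

/-- `Step D γ p φ α q`: `p` can perform action `α` under condition `φ` and then proceed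
as `q`. Labels are satisfiable conditions, which is why the rules for evaluation ask for
satisfiability of `σ(φ)`. The rule `evalAssign` has an instance whenever the updated map
is an evaluation map, i.e. whenever `σ(e)` is a closed term `d` over the signature. -/
inductive Step {S : Signature} (D : Algebra S) {V A : Type*} (γ : CommFun A) :
    Proc S V A → CondTerm S V → Action S V A → Proc S V A → Prop
  | act {α} : Step D γ (.act α) .tru α .empty
  | altL {x y φ α x'} : Step D γ x φ α x' → Step D γ (.alt x y) φ α x'
  | altR {x y φ α y'} : Step D γ y φ α y' → Step D γ (.alt x y) φ α y'
  | seqR {x y φ ψ α y'} : Terminates D x φ → Step D γ y ψ α y' → D.Satisfiable (.and φ ψ) →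
      Step D γ (.seq x y) (.and φ ψ) α y'
  | seqL {x y φ α x'} : Step D γ x φ α x' → Step D γ (.seq x y) φ α (.seq x' y)
  | iterR {x y φ α y'} : Step D γ y φ α y' → Step D γ (.iter x y) φ α y'
  | iterL {x y φ α x'} : Step D γ x φ α x' →
      Step D γ (.iter x y) φ α (.seq x' (.iter x y))
  | guard {x φ ψ α x'} : Step D γ x φ α x' → D.Satisfiable (.and φ ψ) →
      Step D γ (.guard ψ x) (.and φ ψ) α x'
  | parL {x y φ α x'} : Step D γ x φ α x' → Step D γ (.par x y) φ α (.par x' y)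
  | parR {x y φ α y'} : Step D γ y φ α y' → Step D γ (.par x y) φ α (.par x y')
  | parBasic {x y φ ψ a b c x' y'} :
      Step D γ x φ (.basic a) x' → Step D γ y ψ (.basic b) y' →
      γ.toFun (some a) (some b) = some c → D.Satisfiable (.and φ ψ) →
      Step D γ (.par x y) (.and φ ψ) (.basic c) (.par x' y')
  | parParam {x y φ ψ a b c es es' x' y'} :
      Step D γ x φ (.param a es) x' → Step D γ y ψ (.param b es') y' →
      es.length = es'.length →
      γ.toFun (some a) (some b) = some c →
      D.Satisfiable (CondTerm.andEqs (.and φ ψ) es es') →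
      Step D γ (.par x y) (CondTerm.andEqs (.and φ ψ) es es') (.param c es) (.par x' y')
  | leftMerge {x y φ α x'} : Step D γ x φ α x' → Step D γ (.leftMerge x y) φ α (.par x' y)
  | commBasic {x y φ ψ a b c x' y'} :
      Step D γ x φ (.basic a) x' → Step D γ y ψ (.basic b) y' →
      γ.toFun (some a) (some b) = some c → D.Satisfiable (.and φ ψ) →
      Step D γ (.commMerge x y) (.and φ ψ) (.basic c) (.par x' y')
  | commParam {x y φ ψ a b c es es' x' y'} :
      Step D γ x φ (.param a es) x' → Step D γ y ψ (.param b es') y' →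
      es.length = es'.length →
      γ.toFun (some a) (some b) = some c →
      D.Satisfiable (CondTerm.andEqs (.and φ ψ) es es') →
      Step D γ (.commMerge x y) (CondTerm.andEqs (.and φ ψ) es es') (.param c es) (.par x' y')
  | encapBasic {H x φ a x'} : Step D γ x φ (.basic a) x' → a ∉ H →
      Step D γ (.encap H x) φ (.basic a) (.encap H x')
  | encapParam {H x φ a es x'} : Step D γ x φ (.param a es) x' → a ∉ H →
      Step D γ (.encap H x) φ (.param a es) (.encap H x')
  | encapAssign {H x φ v e x'} : Step D γ x φ (.assign v e) x' →
      Step D γ (.encap H x) φ (.assign v e) (.encap H x')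
  | evalBasic {σ x φ a x'} : Step D γ x φ (.basic a) x' → D.Satisfiable (σ.onCond φ) →
      Step D γ (.eval σ x) (σ.onCond φ) (.basic a) (.eval σ x')
  | evalParam {σ x φ a es x'} : Step D γ x φ (.param a es) x' → D.Satisfiable (σ.onCond φ) →
      Step D γ (.eval σ x) (σ.onCond φ) (.param a (es.map σ.onData)) (.eval σ x')
  | evalAssign {σ x φ v e x' d} : Step D γ x φ (.assign v e) x' → D.Satisfiable (σ.onCond φ) →
      σ.Assigned v → σ.onData e = DTerm.embed d →
      Step D γ (.eval σ x) (σ.onCond φ) (.assign v (σ.onData e)) (.eval (σ.update v d) x')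
  | evalAssign' {σ x φ v e x'} : Step D γ x φ (.assign v e) x' → D.Satisfiable (σ.onCond φ) →
      ¬ σ.Assigned v →
      Step D γ (.eval σ x) (σ.onCond φ) (.assign v (σ.onData e)) (.eval σ x')

/-- Data equivalence of actions. -/
inductive DataEquiv {S : Signature} (D : Algebra S) {V A : Type*} :
    Action S V A → Action S V A → Prop
  | basic (a : A) : DataEquiv D (.basic a) (.basic a)
  | param (a : A) {es es' : List (DataTerm S V)}
      (h : List.Forall₂ (fun e e' => D.Valid (CondTerm.eqData e e')) es es') :
      DataEquiv D (.param a es) (.param a es')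
  | assign (v : V) {e e' : DataTerm S V} (h : D.Valid (CondTerm.eqData e e')) :
      DataEquiv D (.assign v e) (.assign v e')

/-- (Splitting) bisimulations. The finite set of conditions is given by listing its elements. -/
def IsBisimulation {S : Signature} (D : Algebra S) {V A : Type*} (γ : CommFun A)
    (R : Proc S V A → Proc S V A → Prop) : Prop :=
  ∀ p q, R p q →
    (∀ φ α p', Step D γ p φ α p' →
      ∃ Ψ : List (CondTerm S V), (∀ ψ ∈ Ψ, D.Satisfiable ψ) ∧
        D.Valid (.imp φ (CondTerm.bigOr Ψ)) ∧
        ∀ ψ ∈ Ψ, ∃ α' q', DataEquiv D α α' ∧ Step D γ q ψ α' q' ∧ R p' q') ∧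
    (∀ φ α q', Step D γ q φ α q' →
      ∃ Ψ : List (CondTerm S V), (∀ ψ ∈ Ψ, D.Satisfiable ψ) ∧
        D.Valid (.imp φ (CondTerm.bigOr Ψ)) ∧
        ∀ ψ ∈ Ψ, ∃ α' p', DataEquiv D α α' ∧ Step D γ p ψ α' p' ∧ R p' q') ∧
    (∀ φ, Terminates D p φ →
      ∃ Ψ : List (CondTerm S V), (∀ ψ ∈ Ψ, D.Satisfiable ψ) ∧
        D.Valid (.imp φ (CondTerm.bigOr Ψ)) ∧ ∀ ψ ∈ Ψ, Terminates D q ψ) ∧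
    (∀ φ, Terminates D q φ →
      ∃ Ψ : List (CondTerm S V), (∀ ψ ∈ Ψ, D.Satisfiable ψ) ∧
        D.Valid (.imp φ (CondTerm.bigOr Ψ)) ∧ ∀ ψ ∈ Ψ, Terminates D p ψ)

/-- (Splitting) bisimulation equivalence. -/
def Bisim {S : Signature} (D : Algebra S) {V A : Type*} (γ : CommFun A) (p q : Proc S V A) :
    Prop :=
  ∃ R, IsBisimulation D γ R ∧ R p q

/-- `q` can be reached from `p` by performing finitely many actions. -/
def Reachable {S : Signature} (D : Algebra S) {V A : Type*} (γ : CommFun A) :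
    Proc S V A → Proc S V A → Prop :=
  Relation.ReflTransGen (fun p q => ∃ φ α, Step D γ p φ α q)

/-- Evaluation of `p` with `σ` only asks for updates that yield evaluation maps: whenever `p` can
at some stage perform an assignment `[v := e]` to a variable `v` that has a value under `σ`,
the new value `σ(e)` of `v` is a closed term over the signature. Since updates do not change the
set of variables that have a value, it suffices to ask this of `σ` itself. -/
def UpdatesDefined {S : Signature} (D : Algebra S) {V A : Type*} (γ : CommFun A)
    (σ : EvalMap S V) (p : Proc S V A) : Prop :=
  ∀ q φ v e q', Reachable D γ p q → Step D γ q φ (.assign v e) q' → σ.Assigned v →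
    ∃ d : DataVal S, σ.onData e = DTerm.embed d

end ACP

/-!
Matching of transitions is phrased with `Covers D φ Q`: the condition `φ` entails a finite
disjunction of satisfiable conditions all of which satisfy `Q`. Covers can be chained
(`Covers.bind`), and a cover by a condition that turns out unsatisfiable may be discarded
(`Covers.of_list`); these two facts account for the satisfiability premises of the transition rules.

For the congruence property, let `CongClosure` be the closure of bisimilarity under all operators,
where for evaluation the two maps may differ as long as they are equivalent: they give values to the
same variables, and these values are equal in the algebra. Distinct maps are unavoidable, since
matching assignments `[v := e]` and `[v := e']` carry terms `e` and `e'` that need only be equal in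
the algebra, so that the updated maps are not syntactically the same. That the matching process can
perform the update at all is what `UpdatesDefined` provides; this property is inherited along
transitions because it depends only on which variables have values
(`EvalMap.onData_eq_embed_congr`). The closure is symmetric, and an induction on its derivations,
operator by operator, shows that it is a simulation (`CongClosure.sim`). Hence it is a bisimulation,
and therefore contained in bisimilarity.
-/

namespace ACP

/-! ### Semantics of conditions -/

section Conditions

variable {S : Signature} {D : Algebra S} {V : Type*}

theorem DTerm.value_bind {X Y : Type*} (f : X → DTerm S Y S.data) (ν : Y → D.Carrier S.data)
    {s : S.Srt} (t : DTerm S X s) :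
    (t.bind f).value D ν = t.value D (fun x => (f x).value D ν) := by
  induction t with
  | var x => rfl
  | op o args ih =>
    simp only [DTerm.bind, DTerm.value]
    congr 1
    funext i
    exact ih i

theorem DTerm.value_embed {X : Type*} (ν : X → D.Carrier S.data) (d : DataVal S) :
    (DTerm.embed d : DTerm S X S.data).value D ν = d.value D (fun x => x.elim) := by
  rw [DTerm.embed, DTerm.value_bind]
  congr 1
  funext x
  exact x.elim

theorem Algebra.satisfiable_iff {φ : CondTerm S V} :
    D.Satisfiable φ ↔ ∃ ν, φ.Holds D ν Fin.elim0 := by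
  simp [Algebra.Satisfiable, Algebra.Valid, CondTerm.iff, Cond.Holds]

theorem CondTerm.holds_bigOr {Ψ : List (CondTerm S V)} {ν : V → D.Carrier S.data} :
    (CondTerm.bigOr Ψ).Holds D ν Fin.elim0 ↔ ∃ ψ ∈ Ψ, ψ.Holds D ν Fin.elim0 := by
  induction Ψ with
  | nil => simp [CondTerm.bigOr, Cond.Holds]
  | cons ψ Ψ ih =>
    have : (CondTerm.bigOr (ψ :: Ψ)).Holds D ν Fin.elim0 ↔
      ψ.Holds D ν Fin.elim0 ∨ (CondTerm.bigOr Ψ).Holds D ν Fin.elim0 := Iff.rfl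
    rw [this, ih]
    simp

theorem CondTerm.holds_eqData {e e' : DataTerm S V} {ν : V → D.Carrier S.data} :
    (CondTerm.eqData e e').Holds D ν Fin.elim0 ↔ e.value D ν = e'.value D ν := by
  simp [CondTerm.eqData, Cond.Holds, DTerm.value_bind, DTerm.value]

theorem Algebra.valid_eqData {e e' : DataTerm S V} :
    D.Valid (CondTerm.eqData e e') ↔ ∀ ν, e.value D ν = e'.value D ν :=
  forall_congr' fun _ => CondTerm.holds_eqData

theorem CondTerm.holds_andEqs {χ : CondTerm S V} {es es' : List (DataTerm S V)}
    (hl : es.length = es'.length) {ν : V → D.Carrier S.data} :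
    (CondTerm.andEqs χ es es').Holds D ν Fin.elim0 ↔
      χ.Holds D ν Fin.elim0 ∧ es.map (DTerm.value D ν) = es'.map (DTerm.value D ν) := by
  induction es generalizing χ es' with
  | nil =>
    cases es' with
    | nil => simp [CondTerm.andEqs]
    | cons => simp at hl
  | cons e es ih =>
    cases es' with
    | nil => simp at hl
    | cons e' es' =>
      have h := ih (χ := .and χ (CondTerm.eqData e e')) (es' := es') (by simpa using hl)
      have h' : CondTerm.andEqs χ (e :: es) (e' :: es') =
        CondTerm.andEqs (.and χ (CondTerm.eqData e e')) es es' := rfl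
      rw [h', h]
      simp [Cond.Holds, CondTerm.holds_eqData, and_assoc]

end Conditions

/-! ### Covers -/

section Covers

variable {S : Signature} {D : Algebra S} {V : Type*}

/-- `φ` entails the disjunction of finitely many satisfiable conditions that satisfy `Q`. The body
is literally the matching clause in the definition of bisimulations. -/
def Covers (D : Algebra S) (φ : CondTerm S V) (Q : CondTerm S V → Prop) : Prop :=
  ∃ Ψ : List (CondTerm S V), (∀ ψ ∈ Ψ, D.Satisfiable ψ) ∧
    D.Valid (.imp φ (CondTerm.bigOr Ψ)) ∧ ∀ ψ ∈ Ψ, Q ψ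

variable {φ χ : CondTerm S V} {P Q : CondTerm S V → Prop}

open Classical in
/-- Unsatisfiable members of a cover can be dropped. -/
theorem Covers.of_list (Ψ : List (CondTerm S V)) (hQ : ∀ ψ ∈ Ψ, D.Satisfiable ψ → Q ψ)
    (h : ∀ ν : V → D.Carrier S.data, φ.Holds D ν Fin.elim0 → ∃ ψ ∈ Ψ, ψ.Holds D ν Fin.elim0) :
    Covers D φ Q := by
  refine ⟨Ψ.filter (fun ψ => D.Satisfiable ψ), fun ψ hψ => by simpa using (List.mem_filter.1 hψ).2,
    fun ν hν => ?_, fun ψ hψ => ?_⟩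
  · obtain ⟨ψ, hψ, hs⟩ := h ν hν
    exact CondTerm.holds_bigOr.2
      ⟨ψ, List.mem_filter.2 ⟨hψ, by simpa using Algebra.satisfiable_iff.2 ⟨ν, hs⟩⟩, hs⟩
  · obtain ⟨h1, h2⟩ := List.mem_filter.1 hψ
    exact hQ ψ h1 (by simpa using h2)

theorem Covers.exists_list (h : Covers D φ Q) :
    ∃ Ψ : List (CondTerm S V), (∀ ψ ∈ Ψ, Q ψ) ∧
      ∀ ν : V → D.Carrier S.data, φ.Holds D ν Fin.elim0 → ∃ ψ ∈ Ψ, ψ.Holds D ν Fin.elim0 := by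
  obtain ⟨Ψ, -, h2, h3⟩ := h
  exact ⟨Ψ, h3, fun ν hν => CondTerm.holds_bigOr.1 (h2 ν hν)⟩

theorem Covers.single (ψ : CondTerm S V)
    (h : ∀ ν : V → D.Carrier S.data, φ.Holds D ν Fin.elim0 → ψ.Holds D ν Fin.elim0)
    (hQ : D.Satisfiable ψ → Q ψ) : Covers D φ Q :=
  .of_list [ψ] (by simpa using hQ) (by simpa using h)

theorem Covers.mono (h : Covers D φ P) (hPQ : ∀ ψ, P ψ → Q ψ) : Covers D φ Q := by
  obtain ⟨Ψ, h1, h2, h3⟩ := h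
  exact ⟨Ψ, h1, h2, fun ψ hψ => hPQ ψ (h3 ψ hψ)⟩

/-- If `χ` entails `φ`, then `χ` can be covered by covering its intersection with each member of a
cover of `φ`. -/
theorem Covers.bind (h : Covers D φ P)
    (hχ : ∀ ν : V → D.Carrier S.data, χ.Holds D ν Fin.elim0 → φ.Holds D ν Fin.elim0)
    (hk : ∀ ψ, P ψ → Covers D (.and χ ψ) Q) : Covers D χ Q := by
  obtain ⟨Ψ, h1, h2⟩ := h.exists_list
  choose! k hk1 hk2 using fun ψ hψ => (hk ψ (h1 ψ hψ)).exists_list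
  refine .of_list (Ψ.flatMap k) (fun θ hθ _ => ?_) (fun ν hν => ?_)
  · obtain ⟨ψ, hψ, hθ⟩ := List.mem_flatMap.1 hθ
    exact hk1 ψ hψ θ hθ
  · obtain ⟨ψ, hψ, hs⟩ := h2 ν (hχ ν hν)
    obtain ⟨θ, hθ, ht⟩ := hk2 ψ hψ ν ⟨hν, hs⟩
    exact ⟨θ, List.mem_flatMap.2 ⟨ψ, hψ, hθ⟩, ht⟩

theorem Covers.trans (h : Covers D φ P) (hk : ∀ ψ, P ψ → Covers D ψ Q) : Covers D φ Q :=
  h.bind (fun _ => id) fun ψ hψ => (hk ψ hψ).bind (fun _ h => h.2) fun θ hθ =>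
    .single θ (fun _ h => h.2) fun _ => hθ

theorem Covers.and {ψ : CondTerm S V} (h : Covers D φ P) (h' : Covers D ψ Q) :
    Covers D (.and φ ψ)
      (fun χ => ∃ φ' ψ', χ = .and φ' ψ' ∧ P φ' ∧ Q ψ' ∧ D.Satisfiable (.and φ' ψ')) :=
  h.bind (fun _ h => h.1) fun φ' hφ => h'.bind (fun _ h => h.1.2) fun ψ' hψ =>
    .single (.and φ' ψ') (fun _ h => ⟨h.1.2, h.2⟩) fun hs => ⟨φ', ψ', rfl, hφ, hψ, hs⟩

theorem Covers.and_right (h : Covers D φ P) (ψ : CondTerm S V) :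
    Covers D (.and φ ψ)
      (fun χ => ∃ φ', χ = .and φ' ψ ∧ P φ' ∧ D.Satisfiable (.and φ' ψ)) :=
  h.bind (fun _ h => h.1) fun φ' hφ =>
    .single (.and φ' ψ) (fun _ h => ⟨h.2, h.1.2⟩) fun hs => ⟨φ', rfl, hφ, hs⟩

end Covers

/-! ### Data equivalence of actions -/

section DataEquiv

variable {S : Signature} {D : Algebra S} {V A : Type*}

theorem DataEquiv.refl (α : Action S V A) : DataEquiv D α α := by
  have h (e : DataTerm S V) : D.Valid (CondTerm.eqData e e) :=
    Algebra.valid_eqData.2 fun _ => rfl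
  cases α with
  | basic a => exact .basic a
  | param a es => exact .param a (List.forall₂_same.2 fun e _ => h e)
  | assign v e => exact .assign v (h e)

/-- Parameterized actions are data equivalent when their argument lists have the same lists of
values under all valuations. The lengths are compared separately: there may be no valuations. -/
theorem forall₂_valid_iff {es es' : List (DataTerm S V)} :
    List.Forall₂ (fun e e' => D.Valid (CondTerm.eqData e e')) es es' ↔
      es.length = es'.length ∧
        ∀ ν : V → D.Carrier S.data, es.map (DTerm.value D ν) = es'.map (DTerm.value D ν) := by
  induction es generalizing es' with
  | nil => cases es' <;> simp
  | cons e es ih =>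
    cases es' with
    | nil => simp
    | cons e' es' => rw [List.forall₂_cons, ih, Algebra.valid_eqData]; simp [forall_and]; tauto

theorem DataEquiv.trans {α β κ : Action S V A} (h : DataEquiv D α β) (h' : DataEquiv D β κ) :
    DataEquiv D α κ := by
  cases h with
  | basic a => exact h'
  | param a h =>
    cases h' with
    | param _ h' =>
      rw [forall₂_valid_iff] at h h'
      exact .param a (forall₂_valid_iff.2 ⟨h.1.trans h'.1, fun ν => (h.2 ν).trans (h'.2 ν)⟩)
  | assign v h =>
    cases h' with
    | assign _ h' =>
      rw [Algebra.valid_eqData] at h h'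
      exact .assign v (Algebra.valid_eqData.2 fun ν => (h ν).trans (h' ν))

end DataEquiv

/-! ### Evaluation maps -/

section EvalMap

variable {S : Signature} {D : Algebra S} {V : Type*}

/-- The valuation obtained from `ν` by overriding it with the values that `σ` assigns. -/
def EvalMap.valuation (D : Algebra S) (σ : EvalMap S V) (ν : V → D.Carrier S.data) (v : V) :
    D.Carrier S.data :=
  (σ.term id v).value D ν

theorem EvalMap.value_term {X : Type*} (σ : EvalMap S V) (ι : V → X) (v : V)
    (ν : X → D.Carrier S.data) :
    (σ.term ι v).value D ν = σ.valuation D (ν ∘ ι) v := by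
  unfold EvalMap.valuation EvalMap.term
  cases σ.toFun v <;> simp [DTerm.value_embed, DTerm.value]

theorem EvalMap.value_onData (σ : EvalMap S V) (e : DataTerm S V) (ν : V → D.Carrier S.data) :
    (σ.onData e).value D ν = e.value D (σ.valuation D ν) :=
  DTerm.value_bind _ _ _

theorem EvalMap.holds_onCond (σ : EvalMap S V) {n : ℕ} (φ : Cond S V n)
    (ν : V → D.Carrier S.data) (ρ : Fin n → D.Carrier S.data) :
    (σ.onCond φ).Holds D ν ρ ↔ φ.Holds D (σ.valuation D ν) ρ := by
  induction φ with
  | @eq n e e' =>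
    have h : (fun x : V ⊕ Fin n => DTerm.value D (Sum.elim ν ρ)
        (Sum.elim (σ.term Sum.inl) (fun i => .var (.inr i)) x)) =
        Sum.elim (σ.valuation D ν) ρ := by
      funext x
      cases x with
      | inl v => simp [EvalMap.value_term]
      | inr i => rfl
    simp only [EvalMap.onCond, Cond.Holds, DTerm.value_bind, h]
  | tru => rfl
  | fls => rfl
  | not φ ih => simp only [EvalMap.onCond, Cond.Holds, ih]
  | and φ ψ ih ih' => simp only [EvalMap.onCond, Cond.Holds, ih, ih']
  | or φ ψ ih ih' => simp only [EvalMap.onCond, Cond.Holds, ih, ih']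
  | imp φ ψ ih ih' => simp only [EvalMap.onCond, Cond.Holds, ih, ih']
  | all φ ih => simp only [EvalMap.onCond, Cond.Holds, ih]
  | ex φ ih => simp only [EvalMap.onCond, Cond.Holds, ih]

/-- Evaluation maps that assign values to the same variables, with equal values in the algebra. The
second clause is phrased through the induced valuations. -/
structure EvalMap.Equiv (D : Algebra S) (σ τ : EvalMap S V) : Prop where
  assigned_iff : ∀ v, σ.Assigned v ↔ τ.Assigned v
  valuation_eq : ∀ ν, σ.valuation D ν = τ.valuation D ν

theorem EvalMap.Equiv.refl (σ : EvalMap S V) : σ.Equiv D σ :=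
  ⟨fun _ => Iff.rfl, fun _ => rfl⟩

theorem EvalMap.Equiv.symm {σ τ : EvalMap S V} (h : σ.Equiv D τ) : τ.Equiv D σ :=
  ⟨fun v => (h.assigned_iff v).symm, fun ν => (h.valuation_eq ν).symm⟩

theorem EvalMap.assigned_update {σ : EvalMap S V} {v w : V} {d : DataVal S} :
    (σ.update v d).Assigned w ↔ w = v ∨ σ.Assigned w := by
  by_cases h : w = v
  · subst h
    simp [EvalMap.Assigned, EvalMap.update]
  · simp [EvalMap.Assigned, EvalMap.update, h]

theorem EvalMap.valuation_update_self (σ : EvalMap S V) (v : V) (d : DataVal S)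
    (ν : V → D.Carrier S.data) :
    (σ.update v d).valuation D ν v = d.value D (fun x => x.elim) := by
  simp [EvalMap.valuation, EvalMap.term, EvalMap.update, DTerm.value_embed]

theorem EvalMap.valuation_update_of_ne (σ : EvalMap S V) {v w : V} (h : w ≠ v) (d : DataVal S)
    (ν : V → D.Carrier S.data) :
    (σ.update v d).valuation D ν w = σ.valuation D ν w := by
  simp [EvalMap.valuation, EvalMap.term, EvalMap.update, h]

theorem EvalMap.Equiv.update {σ τ : EvalMap S V} (h : σ.Equiv D τ) (v : V) {d d' : DataVal S}
    (hd : d.value D (fun x => x.elim) = d'.value D (fun x => x.elim)) :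
    (σ.update v d).Equiv D (τ.update v d') := by
  refine ⟨fun w => ?_, fun ν => funext fun w => ?_⟩
  · rw [EvalMap.assigned_update, EvalMap.assigned_update, h.assigned_iff]
  · by_cases hw : w = v
    · subst hw
      simp only [EvalMap.valuation_update_self, hd]
    · simp only [EvalMap.valuation_update_of_ne _ hw, h.valuation_eq]

/-- No symbol from `X` occurs in the term. -/
def DTerm.IsClosed {X : Type*} : {s : S.Srt} → DTerm S X s → Prop
  | _, .var _ => False
  | _, .op _ args => ∀ i, (args i).IsClosed

theorem DTerm.isClosed_bind_empty {X : Type*} (f : Empty → DTerm S X S.data) {s : S.Srt}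
    (t : DTerm S Empty s) : (t.bind f).IsClosed := by
  induction t with
  | var x => exact x.elim
  | op o args ih => exact ih

theorem DTerm.IsClosed.exists_eq_bind {X : Type*} {s : S.Srt} {t : DTerm S X s}
    (h : t.IsClosed) : ∃ d : DTerm S Empty s, t = d.bind (fun x => x.elim) := by
  induction t with
  | var x => exact h.elim
  | op o args ih =>
    choose d hd using fun i => ih i (h i)
    exact ⟨.op o d, by simp only [DTerm.bind, ← hd]⟩

theorem DTerm.exists_eq_embed_iff {X : Type*} {t : DTerm S X S.data} :
    (∃ d, t = DTerm.embed d) ↔ t.IsClosed := by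
  constructor
  · rintro ⟨d, rfl⟩
    exact DTerm.isClosed_bind_empty _ d
  · exact fun h => h.exists_eq_bind

theorem DTerm.isClosed_bind_congr {X Y : Type*} {f g : X → DTerm S Y S.data}
    (hfg : ∀ x, (f x).IsClosed ↔ (g x).IsClosed) {s : S.Srt} (t : DTerm S X s) :
    (t.bind f).IsClosed ↔ (t.bind g).IsClosed := by
  induction t with
  | var x => exact hfg x
  | op o args ih => exact forall_congr' ih

theorem EvalMap.isClosed_term_iff {σ : EvalMap S V} {v : V} :
    (σ.term id v).IsClosed ↔ σ.Assigned v := by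
  unfold EvalMap.term EvalMap.Assigned
  cases σ.toFun v with
  | inl d => exact iff_of_true (DTerm.isClosed_bind_empty _ d) ⟨d, rfl⟩
  | inr w => simp [DTerm.IsClosed]

/-- Whether `σ(e)` is a closed term depends only on which variables have a value under `σ`. -/
theorem EvalMap.onData_eq_embed_congr {σ τ : EvalMap S V}
    (h : ∀ v, σ.Assigned v ↔ τ.Assigned v) (e : DataTerm S V) :
    (∃ d, σ.onData e = DTerm.embed d) ↔ ∃ d, τ.onData e = DTerm.embed d := by
  rw [DTerm.exists_eq_embed_iff, DTerm.exists_eq_embed_iff]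
  exact DTerm.isClosed_bind_congr
    (fun v => by rw [EvalMap.isClosed_term_iff, EvalMap.isClosed_term_iff, h v]) e

theorem Covers.onCond {σ τ : EvalMap S V} (hστ : σ.Equiv D τ) {φ : CondTerm S V}
    {P : CondTerm S V → Prop} (h : Covers D φ P) :
    Covers D (σ.onCond φ)
      (fun χ => ∃ ψ, χ = τ.onCond ψ ∧ P ψ ∧ D.Satisfiable (τ.onCond ψ)) := by
  obtain ⟨Ψ, h1, h2⟩ := h.exists_list
  refine .of_list (Ψ.map τ.onCond) (fun χ hχ hs => ?_) (fun ν hν => ?_)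
  · obtain ⟨ψ, hψ, rfl⟩ := List.mem_map.1 hχ
    exact ⟨ψ, rfl, h1 ψ hψ, hs⟩
  · obtain ⟨ψ, hψ, hs⟩ := h2 _ ((σ.holds_onCond φ ν _).1 hν)
    rw [hστ.valuation_eq] at hs
    exact ⟨_, List.mem_map_of_mem hψ, (τ.holds_onCond ψ ν _).2 hs⟩

theorem EvalMap.Equiv.valid_onData {σ τ : EvalMap S V} (hστ : σ.Equiv D τ) {e e' : DataTerm S V}
    (h : D.Valid (CondTerm.eqData e e')) :
    D.Valid (CondTerm.eqData (σ.onData e) (τ.onData e')) := by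
  rw [Algebra.valid_eqData] at h ⊢
  intro ν
  rw [EvalMap.value_onData, EvalMap.value_onData, hστ.valuation_eq, h]

end EvalMap

/-! ### Bisimilarity -/

section Bisimilarity

variable {S : Signature} {D : Algebra S} {V A : Type*} {γ : CommFun A}

/-- Transitions and terminations of `p` are matched by those of `q`, up to `R` for the targets of
transitions. -/
structure Sim (D : Algebra S) (γ : CommFun A) (R : Proc S V A → Proc S V A → Prop)
    (p q : Proc S V A) : Prop where
  step : ∀ {φ α p'}, Step D γ p φ α p' →
    Covers D φ fun ψ => ∃ α' q', DataEquiv D α α' ∧ Step D γ q ψ α' q' ∧ R p' q'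
  term : ∀ {φ}, Terminates D p φ → Covers D φ fun ψ => Terminates D q ψ

variable {R R' : Proc S V A → Proc S V A → Prop} {p q r : Proc S V A}

theorem Sim.mono (h : Sim D γ R p q) (hR : ∀ p q, R p q → R' p q) : Sim D γ R' p q where
  step hs := (h.step hs).mono fun _ ⟨α', q', h1, h2, h3⟩ => ⟨α', q', h1, h2, hR _ _ h3⟩
  term := h.term

theorem Sim.refl (hR : ∀ p, R p p) (p : Proc S V A) : Sim D γ R p p where
  step hs := .single _ (fun _ => id) fun _ => ⟨_, _, .refl _, hs, hR _⟩
  term ht := .single _ (fun _ => id) fun _ => ht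

theorem Sim.comp (h : Sim D γ R p q) (h' : Sim D γ R' q r) : Sim D γ (Relation.Comp R R') p r where
  step hs := (h.step hs).trans fun _ ⟨_, _, h1, h2, h3⟩ =>
    (h'.step h2).mono fun _ ⟨α', q', k1, k2, k3⟩ => ⟨α', q', h1.trans k1, k2, _, h3, k3⟩
  term ht := (h.term ht).trans fun _ => h'.term

theorem isBisimulation_iff :
    IsBisimulation D γ R ↔ ∀ p q, R p q → Sim D γ R p q ∧ Sim D γ (flip R) q p :=
  ⟨fun h p q hR => ⟨⟨(h p q hR).1 _ _ _, (h p q hR).2.2.1 _⟩,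
      ⟨(h p q hR).2.1 _ _ _, (h p q hR).2.2.2 _⟩⟩,
    fun h p q hR => ⟨fun _ _ _ => (h p q hR).1.step, fun _ _ _ => (h p q hR).2.step,
      fun _ => (h p q hR).1.term, fun _ => (h p q hR).2.term⟩⟩

theorem Bisim.of_symmetric_sim (hsymm : ∀ {p q}, R p q → R q p)
    (hsim : ∀ {p q}, R p q → Sim D γ R p q) (h : R p q) : Bisim D γ p q :=
  ⟨R, isBisimulation_iff.2 fun _ _ h =>
    ⟨hsim h, (hsim (hsymm h)).mono fun _ _ => hsymm⟩, h⟩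

theorem Bisim.refl (p : Proc S V A) : Bisim D γ p p :=
  .of_symmetric_sim (R := Eq) Eq.symm (fun h => h ▸ Sim.refl (fun _ => rfl) _) rfl

theorem Bisim.symm (h : Bisim D γ p q) : Bisim D γ q p := by
  obtain ⟨R, hR, h⟩ := h
  rw [isBisimulation_iff] at hR
  exact ⟨flip R, isBisimulation_iff.2 fun p q h => (hR q p h).symm, h⟩

theorem Bisim.trans (h : Bisim D γ p q) (h' : Bisim D γ q r) : Bisim D γ p r := by
  obtain ⟨R, hR, h⟩ := h
  obtain ⟨R', hR', h'⟩ := h'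
  rw [isBisimulation_iff] at hR hR'
  refine ⟨Relation.Comp R R', isBisimulation_iff.2 ?_, q, h, h'⟩
  rintro p r ⟨q, h, h'⟩
  refine ⟨(hR p q h).1.comp (hR' q r h').1, ((hR' q r h').2.comp (hR p q h).2).mono ?_⟩
  rintro _ _ ⟨q, h1, h2⟩
  exact ⟨q, h2, h1⟩

theorem Bisim.sim (h : Bisim D γ p q) : Sim D γ (Bisim D γ) p q := by
  obtain ⟨R, hR, h⟩ := h
  exact (isBisimulation_iff.1 hR p q h).1.mono fun _ _ h => ⟨R, hR, h⟩

/-! ### Matching transitions of composed processes -/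

theorem Sim.communication_basic {p' q' x y : Proc S V A} {a b : A} {φ ψ : CondTerm S V}
    (hp : Sim D γ R p p') (hq : Sim D γ R q q')
    (hx : Step D γ p φ (.basic a) x) (hy : Step D γ q ψ (.basic b) y) :
    Covers D (.and φ ψ) fun χ => ∃ φ' ψ' x' y', χ = .and φ' ψ' ∧ D.Satisfiable (.and φ' ψ') ∧
      Step D γ p' φ' (.basic a) x' ∧ Step D γ q' ψ' (.basic b) y' ∧ R x x' ∧ R y y' := by
  refine ((hp.step hx).and (hq.step hy)).mono ?_
  rintro _ ⟨φ', ψ', rfl, ⟨_, x', ⟨⟩, hx', hRx⟩, ⟨_, y', ⟨⟩, hy', hRy⟩, hs⟩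
  exact ⟨φ', ψ', x', y', rfl, hs, hx', hy', hRx, hRy⟩

theorem Sim.communication_param {p' q' x y : Proc S V A} {a b : A} {φ ψ : CondTerm S V}
    {es fs : List (DataTerm S V)} (hp : Sim D γ R p p') (hq : Sim D γ R q q')
    (hx : Step D γ p φ (.param a es) x) (hy : Step D γ q ψ (.param b fs) y)
    (hl : es.length = fs.length) :
    Covers D (CondTerm.andEqs (.and φ ψ) es fs) fun χ => ∃ φ' ψ' es' fs' x' y',
      χ = CondTerm.andEqs (.and φ' ψ') es' fs' ∧
      D.Satisfiable (CondTerm.andEqs (.and φ' ψ') es' fs') ∧ es'.length = fs'.length ∧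
      List.Forall₂ (fun e e' => D.Valid (CondTerm.eqData e e')) es es' ∧
      Step D γ p' φ' (.param a es') x' ∧ Step D γ q' ψ' (.param b fs') y' ∧ R x x' ∧ R y y' := by
  refine ((hp.step hx).and (hq.step hy)).bind
    (fun ν h => ((CondTerm.holds_andEqs hl).1 h).1) ?_
  rintro _ ⟨φ', ψ', rfl, ⟨_, x', he, hx', hRx⟩, ⟨_, y', hf, hy', hRy⟩, -⟩
  cases he with | @param _ _ es' he => ?_
  cases hf with | @param _ _ fs' hf => ?_
  have he' := forall₂_valid_iff.1 he
  have hf' := forall₂_valid_iff.1 hf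
  have hl' : es'.length = fs'.length := he'.1.symm.trans (hl.trans hf'.1)
  refine .single (CondTerm.andEqs (.and φ' ψ') es' fs') (fun ν h => ?_) fun hs =>
    ⟨φ', ψ', es', fs', x', y', rfl, hs, hl', he, hx', hy', hRx, hRy⟩
  refine (CondTerm.holds_andEqs hl').2 ⟨h.2, ?_⟩
  rw [← he'.2 ν, ← hf'.2 ν]
  exact ((CondTerm.holds_andEqs hl).1 h.1).2

theorem UpdatesDefined.of_step {σ : EvalMap S V} {p p' : Proc S V A} {φ : CondTerm S V}
    {α : Action S V A} (h : UpdatesDefined D γ σ p) (hs : Step D γ p φ α p') :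
    UpdatesDefined D γ σ p' :=
  fun q ψ v e q' hr => h q ψ v e q' (.head ⟨φ, α, hs⟩ hr)

theorem UpdatesDefined.update {σ : EvalMap S V} {p : Proc S V A} {v : V}
    (h : UpdatesDefined D γ σ p) (hv : σ.Assigned v) (d : DataVal S) :
    UpdatesDefined D γ (σ.update v d) p := by
  have hσ (w : V) : (σ.update v d).Assigned w ↔ σ.Assigned w := by
    rw [EvalMap.assigned_update]
    exact or_iff_right_of_imp fun h => h ▸ hv
  intro q ψ w e q' hr hs hw
  exact (EvalMap.onData_eq_embed_congr hσ e).2 (h q ψ w e q' hr hs ((hσ w).1 hw))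

/-! ### The congruence closure of bisimilarity -/

/-- The closure of bisimilarity under the operators of the process algebra; evaluation maps may be
replaced by equivalent ones. -/
inductive CongClosure (D : Algebra S) (γ : CommFun A) : Proc S V A → Proc S V A → Prop
  | of_bisim {p p'} : Bisim D γ p p' → CongClosure D γ p p'
  | alt {p p' q q'} : CongClosure D γ p p' → CongClosure D γ q q' →
      CongClosure D γ (.alt p q) (.alt p' q')
  | seq {p p' q q'} : CongClosure D γ p p' → CongClosure D γ q q' →
      CongClosure D γ (.seq p q) (.seq p' q')
  | iter {p p' q q'} : CongClosure D γ p p' → CongClosure D γ q q' →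
      CongClosure D γ (.iter p q) (.iter p' q')
  | guard {φ p p'} : CongClosure D γ p p' → CongClosure D γ (.guard φ p) (.guard φ p')
  | par {p p' q q'} : CongClosure D γ p p' → CongClosure D γ q q' →
      CongClosure D γ (.par p q) (.par p' q')
  | leftMerge {p p' q q'} : CongClosure D γ p p' → CongClosure D γ q q' →
      CongClosure D γ (.leftMerge p q) (.leftMerge p' q')
  | commMerge {p p' q q'} : CongClosure D γ p p' → CongClosure D γ q q' →
      CongClosure D γ (.commMerge p q) (.commMerge p' q')
  | encap {H p p'} : CongClosure D γ p p' → CongClosure D γ (.encap H p) (.encap H p')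
  | eval {σ τ p p'} : CongClosure D γ p p' → σ.Equiv D τ →
      UpdatesDefined D γ σ p → UpdatesDefined D γ τ p' →
      CongClosure D γ (.eval σ p) (.eval τ p')

theorem CongClosure.symm (h : CongClosure D γ p q) : CongClosure D γ q p := by
  induction h with
  | of_bisim h => exact .of_bisim h.symm
  | alt _ _ ih ih' => exact .alt ih ih'
  | seq _ _ ih ih' => exact .seq ih ih'
  | iter _ _ ih ih' => exact .iter ih ih'
  | guard _ ih => exact .guard ih
  | par _ _ ih ih' => exact .par ih ih'
  | leftMerge _ _ ih ih' => exact .leftMerge ih ih'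
  | commMerge _ _ ih ih' => exact .commMerge ih ih'
  | encap _ ih => exact .encap ih
  | eval _ h hσ hτ ih => exact .eval ih h.symm hτ hσ

/-- Evaluation preserves the matching of transitions. In the case of an assignment to a variable
that has a value, both sides update their maps, by closed terms that are equal in the algebra. -/
theorem CongClosure.sim_eval {σ τ : EvalMap S V} (hστ : σ.Equiv D τ)
    (hσ : UpdatesDefined D γ σ p) (hτ : UpdatesDefined D γ τ q)
    (h : Sim D γ (CongClosure D γ) p q) :
    Sim D γ (CongClosure D γ) (.eval σ p) (.eval τ q) where
  term ht := by
    cases ht with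
    | eval ht hs =>
      refine ((h.term ht).onCond hστ).mono ?_
      rintro _ ⟨ψ, rfl, ht', hs'⟩
      exact .eval ht' hs'
  step hst := by
    cases hst with
    | evalBasic hp hs =>
      refine ((h.step hp).onCond hστ).mono ?_
      rintro _ ⟨ψ, rfl, ⟨_, q', ⟨⟩, hq, hR⟩, hs'⟩
      exact ⟨_, _, .basic _, .evalBasic hq hs', .eval hR hστ (hσ.of_step hp) (hτ.of_step hq)⟩
    | evalParam hp hs =>
      refine ((h.step hp).onCond hστ).mono ?_
      rintro _ ⟨ψ, rfl, ⟨_, q', (_ | ⟨_, he⟩), hq, hR⟩, hs'⟩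
      refine ⟨_, _, .param _ ?_, .evalParam hq hs',
        .eval hR hστ (hσ.of_step hp) (hτ.of_step hq)⟩
      rw [List.forall₂_map_left_iff, List.forall₂_map_right_iff]
      exact he.imp fun _ _ => hστ.valid_onData
    | @evalAssign _ _ _ v e _ d hp hs hv hd =>
      refine ((h.step hp).onCond hστ).mono ?_
      rintro _ ⟨ψ, rfl, ⟨_, q', (_ | _ | ⟨_, he⟩), hq, hR⟩, hs'⟩
      have hv' := (hστ.assigned_iff v).1 hv
      obtain ⟨d', hd'⟩ := hτ _ _ _ _ _ .refl hq hv'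
      have hval := hστ.valid_onData he
      refine ⟨_, _, .assign v hval, .evalAssign hq hs' hv' hd',
        .eval hR (hστ.update v ?_) ((hσ.of_step hp).update hv d) ((hτ.of_step hq).update hv' d')⟩
      -- The closed term `d` itself witnesses that there is a valuation.
      have := Algebra.valid_eqData.1 hval fun _ => d.value D (fun x => x.elim)
      rwa [hd, hd', DTerm.value_embed, DTerm.value_embed] at this
    | @evalAssign' _ _ _ v e _ hp hs hv =>
      refine ((h.step hp).onCond hστ).mono ?_
      rintro _ ⟨ψ, rfl, ⟨_, q', (_ | _ | ⟨_, he⟩), hq, hR⟩, hs'⟩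
      exact ⟨_, _, .assign v (hστ.valid_onData he),
        .evalAssign' hq hs' (mt (hστ.assigned_iff v).2 hv),
        .eval hR hστ (hσ.of_step hp) (hτ.of_step hq)⟩

theorem CongClosure.sim (h : CongClosure D γ p q) : Sim D γ (CongClosure D γ) p q := by
  induction h with
  | of_bisim h => exact h.sim.mono fun _ _ => .of_bisim
  | alt _ _ ihp ihq =>
    constructor
    · intro φ α r hst
      cases hst with
      | altL hs =>
        exact (ihp.step hs).mono fun _ ⟨_, _, hα, h, hR⟩ => ⟨_, _, hα, .altL h, hR⟩
      | altR hs =>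
        exact (ihq.step hs).mono fun _ ⟨_, _, hα, h, hR⟩ => ⟨_, _, hα, .altR h, hR⟩
    · intro φ ht
      cases ht with
      | altL ht => exact (ihp.term ht).mono fun _ => .altL
      | altR ht => exact (ihq.term ht).mono fun _ => .altR
  | seq hp hq ihp ihq =>
    constructor
    · intro φ α r hst
      cases hst with
      | seqL hs =>
        exact (ihp.step hs).mono fun _ ⟨_, _, hα, h, hR⟩ => ⟨_, _, hα, .seqL h, .seq hR hq⟩
      | seqR ht hs _ =>
        refine ((ihp.term ht).and (ihq.step hs)).mono ?_
        rintro _ ⟨φ', ψ', rfl, ht', ⟨_, _, hα, h, hR⟩, hsat⟩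
        exact ⟨_, _, hα, .seqR ht' h hsat, hR⟩
    · intro φ ht
      cases ht with
      | seq ht ht' _ =>
        refine ((ihp.term ht).and (ihq.term ht')).mono ?_
        rintro _ ⟨φ', ψ', rfl, h, h', hsat⟩
        exact .seq h h' hsat
  | iter hp hq ihp ihq =>
    constructor
    · intro φ α r hst
      cases hst with
      | iterL hs =>
        exact (ihp.step hs).mono fun _ ⟨_, _, hα, h, hR⟩ =>
          ⟨_, _, hα, .iterL h, .seq hR (.iter hp hq)⟩
      | iterR hs =>
        exact (ihq.step hs).mono fun _ ⟨_, _, hα, h, hR⟩ => ⟨_, _, hα, .iterR h, hR⟩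
    · intro φ ht
      cases ht with
      | iter ht => exact (ihq.term ht).mono fun _ => .iter
  | guard hp ihp =>
    constructor
    · intro φ α r hst
      cases hst with
      | guard hs _ =>
        refine ((ihp.step hs).and_right _).mono ?_
        rintro _ ⟨φ', rfl, ⟨_, _, hα, h, hR⟩, hsat⟩
        exact ⟨_, _, hα, .guard h hsat, hR⟩
    · intro φ ht
      cases ht with
      | guard ht _ =>
        refine ((ihp.term ht).and_right _).mono ?_
        rintro _ ⟨φ', rfl, h, hsat⟩
        exact .guard h hsat
  | par hp hq ihp ihq =>
    constructor
    · intro φ α r hst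
      cases hst with
      | parL hs =>
        exact (ihp.step hs).mono fun _ ⟨_, _, hα, h, hR⟩ => ⟨_, _, hα, .parL h, .par hR hq⟩
      | parR hs =>
        exact (ihq.step hs).mono fun _ ⟨_, _, hα, h, hR⟩ => ⟨_, _, hα, .parR h, .par hp hR⟩
      | parBasic hx hy hγ _ =>
        refine (ihp.communication_basic ihq hx hy).mono ?_
        rintro _ ⟨_, _, _, _, rfl, hsat, hx', hy', hRx, hRy⟩
        exact ⟨_, _, .basic _, .parBasic hx' hy' hγ hsat, .par hRx hRy⟩
      | parParam hx hy hl hγ _ =>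
        refine (ihp.communication_param ihq hx hy hl).mono ?_
        rintro _ ⟨_, _, _, _, _, _, rfl, hsat, hl', he, hx', hy', hRx, hRy⟩
        exact ⟨_, _, .param _ he, .parParam hx' hy' hl' hγ hsat, .par hRx hRy⟩
    · intro φ ht
      cases ht with
      | par ht ht' _ =>
        refine ((ihp.term ht).and (ihq.term ht')).mono ?_
        rintro _ ⟨φ', ψ', rfl, h, h', hsat⟩
        exact .par h h' hsat
  | leftMerge hp hq ihp _ =>
    constructor
    · intro φ α r hst
      cases hst with
      | leftMerge hs =>
        exact (ihp.step hs).mono fun _ ⟨_, _, hα, h, hR⟩ =>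
          ⟨_, _, hα, .leftMerge h, .par hR hq⟩
    · intro φ ht
      cases ht
  | commMerge hp hq ihp ihq =>
    constructor
    · intro φ α r hst
      cases hst with
      | commBasic hx hy hγ _ =>
        refine (ihp.communication_basic ihq hx hy).mono ?_
        rintro _ ⟨_, _, _, _, rfl, hsat, hx', hy', hRx, hRy⟩
        exact ⟨_, _, .basic _, .commBasic hx' hy' hγ hsat, .par hRx hRy⟩
      | commParam hx hy hl hγ _ =>
        refine (ihp.communication_param ihq hx hy hl).mono ?_
        rintro _ ⟨_, _, _, _, _, _, rfl, hsat, hl', he, hx', hy', hRx, hRy⟩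
        exact ⟨_, _, .param _ he, .commParam hx' hy' hl' hγ hsat, .par hRx hRy⟩
    · intro φ ht
      cases ht
  | encap hp ihp =>
    constructor
    · intro φ α r hst
      cases hst with
      | encapBasic hs ha =>
        refine (ihp.step hs).mono ?_
        rintro _ ⟨_, _, ⟨⟩, h, hR⟩
        exact ⟨_, _, .basic _, .encapBasic h ha, .encap hR⟩
      | encapParam hs ha =>
        refine (ihp.step hs).mono ?_
        rintro _ ⟨_, _, (_ | ⟨_, he⟩), h, hR⟩
        exact ⟨_, _, .param _ he, .encapParam h ha, .encap hR⟩
      | encapAssign hs =>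
        refine (ihp.step hs).mono ?_
        rintro _ ⟨_, _, (_ | _ | ⟨_, he⟩), h, hR⟩
        exact ⟨_, _, .assign _ he, .encapAssign h, .encap hR⟩
    · intro φ ht
      cases ht with
      | encap ht => exact (ihp.term ht).mono fun _ => .encap
  | eval _ hστ hσ hτ ih => exact sim_eval hστ hσ hτ ih

theorem CongClosure.bisim (h : CongClosure D γ p q) : Bisim D γ p q :=
  .of_symmetric_sim CongClosure.symm CongClosure.sim h

end Bisimilarity

end ACP

theorem mainTheorem3 {S : ACP.Signature} (D : ACP.Algebra S) (hD : D.IsMinimal)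
    {V : Type*} [Countable V] [Infinite V] {A : Type*} [Finite A] (γ : ACP.CommFun A) :
    Equivalence (ACP.Bisim (V := V) D γ) ∧
    ∀ (p q p' q' : ACP.Proc S V A) (φ : ACP.CondTerm S V),
      ACP.Bisim D γ p p' → ACP.Bisim D γ q q' →
        ACP.Bisim D γ (.alt p q) (.alt p' q') ∧
        ACP.Bisim D γ (.seq p q) (.seq p' q') ∧
        ACP.Bisim D γ (.iter p q) (.iter p' q') ∧
        ACP.Bisim D γ (.guard φ p) (.guard φ p') ∧
        ACP.Bisim D γ (.par p q) (.par p' q') ∧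
        ACP.Bisim D γ (.leftMerge p q) (.leftMerge p' q') ∧
        ACP.Bisim D γ (.commMerge p q) (.commMerge p' q') ∧
        (∀ H : Set A, ACP.Bisim D γ (.encap H p) (.encap H p')) ∧
        (∀ σ : ACP.EvalMap S V, ACP.UpdatesDefined D γ σ p → ACP.UpdatesDefined D γ σ p' →
          ACP.Bisim D γ (.eval σ p) (.eval σ p')) := by
  refine ⟨⟨.refl, .symm, .trans⟩, fun p q p' q' φ hp hq => ?_⟩
  have cp := ACP.CongClosure.of_bisim hp
  have cq := ACP.CongClosure.of_bisim hq
  exact ⟨(cp.alt cq).bisim, (cp.seq cq).bisim, (cp.iter cq).bisim, cp.guard.bisim,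
    (cp.par cq).bisim, (cp.leftMerge cq).bisim, (cp.commMerge cq).bisim,
    fun _ => cp.encap.bisim, fun σ hσ hσ' => (cp.eval (.refl σ) hσ hσ').bisim⟩
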